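/- Let $\mathscr A$ be an abelian category with enough projectives. All subcategories are full and closed under isomorphisms. Definitions. An object is *Gorenstein-projective* if it is isomorphic to $\operatorname{Coker}(X^{-1}\to X^0)$ for an acyclic complex $X^\bullet$ of projective objects such that $\operatorname{Hom}(X^\bullet,P)$ is acyclic for every projective $P$; $\mathsf{GProj}\,\mathscr A$ is the full subcategory of these objects. A subcategory $\mathcal X\subseteq\mathscr A$ is *resolving* if it contains the projectives and is closed under extensions and kernels of epimorphisms. For $A\in\mathscr A$, $\operatorname{rd}_{\mathcal X}A$ is the least $n$ such that there is an exact sequence $0\to X_n\to\cdots\to X_0\to A\to 0$ with all $X_i\in\mathcal X$ ($\infty$ if there is none), and $\operatorname{rd}_{\mathcal X}\mathscr A=\sup_A \operatorname{rd}_{\mathcal X}A$. $\mathscr A$ is *Gorenstein* if $\operatorname{rd}_{\mathsf{GProj}\mathscr A}\mathscr A<\infty$. $\mathcal X$ is of *finite representation type* if it is Krull-Schmidt (every object is a finite direct sum of indecomposable objects, and indecomposable objects have local endomorphism rings) and has only finitely many isomorphism classes of indecomposable objects. $\mathscr A$ is of *finite CM-type* if $\mathsf{GProj}\,\mathscr A$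 is of finite representation type. A *representation generator* of $\mathcal X$ is an object $T$ with $\mathcal X=\operatorname{add}T$, the class of direct summands of finite direct sums of copies of $T$; then $\mathsf A(\mathcal X)=\operatorname{End}_{\mathscr A}(T)^{\mathrm{op}}$ is the *Auslander algebra* of $\mathcal X$, and $\operatorname{gl.dim}\mathsf A(\mathcal X)$ denotes the global dimension of the category of finitely presented left $\mathsf A(\mathcal X)$-modules (equivalently, of coherent functors $\mathcal X^{\mathrm{op}}\to\mathfrak{Ab}$), i.e. the supremum of the projective dimensions of the finitely presented $\mathsf A(\mathcal X)$-modules. **Corollary 6.13.** (i) $\mathscr A$ is Gorenstein if and only if there is a resolving subcategory $\mathcal X$ of $\mathscr A$ with $\mathcal X\subseteq\mathsf{GProj}\,\mathscr A$ and $\operatorname{rd}_{\mathcal X}\mathscr A<\infty$. Moreover, $\mathscr A$ is Gorenstein and of finite CM-type if and only if there is such an $\mathcal X$ which is in addition of finite representation type. (ii) Suppose that $\mathscr A$ is $R$-linear over a commutative ring $R$ and that the $R$-module $\mathscr A(A,B)$ is finitely generated for all $A,B\in\mathscr A$. Then the following are equivalent: (a) $\mathscr A$ is Gorenstein and of finite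 CM-type. (b) There is a resolving subcategory $\mathcal X\subseteq\mathsf{GProj}\,\mathscr A$ of finite representation type such that $\operatorname{gl.dim}\mathsf A(\mathcal X)<\infty$ for some representation generator of $\mathcal X$. (c) There is a resolving subcategory $\mathcal X\subseteq\mathsf{GProj}\,\mathscr A$ of finite representation type which has a representation generator and such that $\operatorname{gl.dim}\mathsf A(\mathcal X)<\infty$ for every representation generator of $\mathcal X$. -/

import Mathlib

open CategoryTheory CategoryTheory.Limits

universe w v u

namespace GorCM

attribute [local instance] Abelian.hasFiniteBiproducts

variable {𝒜 : Type u} [Category.{v} 𝒜] [Abelian 𝒜]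

/-- A complex of projectives is totally acyclic if it is acyclic and stays acyclic under
`Hom(-, P)` for every projective object `P`. -/
structure IsTotallyAcyclic (K : CochainComplex 𝒜 ℤ) : Prop where
  projective : ∀ i, Projective (K.X i)
  acyclic : K.Acyclic
  hom_acyclic : ∀ (P : 𝒜), Projective P → ∀ i : ℤ,
    Function.Exact (fun g : K.X (i + 1) ⟶ P => K.d i (i + 1) ≫ g)
      (fun f : K.X i ⟶ P => K.d (i - 1) i ≫ f)

variable (𝒜) in
/-- The full subcategory `GProj 𝒜` of Gorenstein-projective objects: the cokernels of
`X⁻¹ ⟶ X⁰` for totally acyclic complexes `X` of projectives. -/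
def GProj : ObjectProperty 𝒜 := fun A =>
  ∃ K : CochainComplex 𝒜 ℤ, IsTotallyAcyclic K ∧ Nonempty (A ≅ cokernel (K.d (-1) 0))

/-- Resolving subcategories. Closure under extensions (with the zero object projective) makes such
a subcategory closed under isomorphisms and finite direct sums. -/
structure IsResolving (X : ObjectProperty 𝒜) : Prop where
  projective : ∀ P : 𝒜, Projective P → X P
  extension : ∀ S : ShortComplex 𝒜, S.ShortExact → X S.X₁ → X S.X₃ → X S.X₂
  kernel : ∀ S : ShortComplex 𝒜, S.ShortExact → X S.X₂ → X S.X₃ → X S.X₁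

/-- `A` admits an exact sequence `0 ⟶ Xₙ ⟶ ⋯ ⟶ X₀ ⟶ A ⟶ 0` with all `Xᵢ` in `X`;
the sequence is recorded by the short exact sequences it is spliced from. -/
def HasResolution (X : ObjectProperty 𝒜) : ℕ → 𝒜 → Prop
  | 0, A => ∃ X₀ : 𝒜, X X₀ ∧ Nonempty (X₀ ≅ A)
  | n + 1, A => ∃ (K X₀ : 𝒜) (i : K ⟶ X₀) (p : X₀ ⟶ A) (h : i ≫ p = 0),
      (ShortComplex.mk i p h).ShortExact ∧ X X₀ ∧ HasResolution X n K

/-- The `X`-resolution dimension of the object `A` (`⊤` if there is no finite resolution). -/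
noncomputable def resDim (X : ObjectProperty 𝒜) (A : 𝒜) : ℕ∞ :=
  ⨅ (n : ℕ) (_ : HasResolution X n A), (n : ℕ∞)

/-- The `X`-resolution dimension of the category. -/
noncomputable def catResDim (X : ObjectProperty 𝒜) : ℕ∞ := ⨆ A : 𝒜, resDim X A

variable (𝒜) in
/-- `𝒜` is Gorenstein. -/
def IsGorenstein : Prop := catResDim (GProj 𝒜) < ⊤

/-- `A` is an indecomposable object of the full subcategory `X`. -/
def IsIndecomposableIn (X : ObjectProperty 𝒜) (A : 𝒜) : Prop :=
  X A ∧ ¬ IsZero A ∧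
    ∀ B C : 𝒜, X B → X C → Nonempty (A ≅ B ⊞ C) → IsZero B ∨ IsZero C

/-- The full subcategory `X` is a Krull-Schmidt category. -/
structure IsKrullSchmidt (X : ObjectProperty 𝒜) : Prop where
  decomposition : ∀ A : 𝒜, X A → ∃ (n : ℕ) (F : Fin n → 𝒜),
    (∀ i, IsIndecomposableIn X (F i)) ∧ Nonempty (A ≅ ⨁ F)
  isLocalRing_end : ∀ A : 𝒜, IsIndecomposableIn X A → IsLocalRing (End A)

/-- The isomorphism classes of indecomposable objects of `X`. -/
def indClasses (X : ObjectProperty 𝒜) : Set (Quotient (isIsomorphicSetoid 𝒜)) :=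
  Quotient.mk (isIsomorphicSetoid 𝒜) '' {A | IsIndecomposableIn X A}

/-- The full subcategory `X` is of finite representation type. (Skeletal smallness is automatic
here.) -/
structure IsOfFiniteRepType (X : ObjectProperty 𝒜) : Prop where
  isKrullSchmidt : IsKrullSchmidt X
  finite_ind : (indClasses X).Finite

variable (𝒜) in
/-- `𝒜` is of finite Cohen-Macaulay type. -/
def IsOfFiniteCMType : Prop := IsOfFiniteRepType (GProj 𝒜)

/-- `add T`: the direct summands of finite direct sums of copies of `T`. -/
def addClosure (T : 𝒜) : ObjectProperty 𝒜 := fun A =>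
  ∃ n : ℕ, Nonempty (Retract A (⨁ fun _ : Fin n => T))

/-- `T` is a representation generator of `X`. -/
def IsRepGenerator (X : ObjectProperty 𝒜) (T : 𝒜) : Prop := X = addClosure T

/-- The Auslander algebra of `add T`. In `End T` the product is `f * g = f ∘ g`, so left modules
over this ring are (for `X = add T`) the same as contravariant additive functors on `X`. -/
abbrev AuslanderAlgebra (T : 𝒜) : Type v := (End T)ᵐᵒᵖ

/-- The global dimension of the category `mod Γ` of finitely presented modules: the supremum of
the projective dimensions of the finitely presented left `Γ`-modules. -/
noncomputable def fpGlobalDim (Γ : Type v) [Ring Γ] : WithBot ℕ∞ :=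
  ⨆ (M : ModuleCat.{v} Γ) (_ : Module.FinitePresentation Γ M), projectiveDimension M

end GorCM

/-! Everything reduces to two facts: `GProj 𝒜` is itself resolving, and a resolving `X` inside it
with finite resolution dimension must equal it. The second holds because a Gorenstein-projective
object is an arbitrarily high syzygy: embed it repeatedly into projectives with
Gorenstein-projective cokernels. By dimension shifting (`HasResolution.syzygy`), each embedding
lowers the bound on its `X`-resolution length by one, so a uniform bound `n` puts it in `X` after
`n` embeddings (`GProj_le_of_hasResolution`).

Resolvingness is proved through an intrinsic criterion: a class whose objects have a projective
cover and a projective embedding staying in the class, and are `Ext¹`-orthogonal to projectives,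
consists of Gorenstein-projectives (`IsGPClass.le_GProj`). It is applied to extensions and to direct
summands of Gorenstein-projectives.

For the Auslander algebra, finiteness of the Hom modules gives right `add T`-approximations, which
`Hom(T, -)` turns into projective presentations. Hence `Hom(T, A)` has projective dimension at most
`n` exactly when `A` has an `add T`-resolution of length `n`. Since every second syzygy of a
finitely presented module can be chosen of the form `Hom(T, A)`, finite global dimension and finite
resolution dimension are equivalent. -/

namespace GorCM

attribute [local instance] Abelian.hasFiniteBiproducts

/-! ### Diagram lemmas for short exact sequences -/

section

variable {𝒜 : Type u} [Category.{v} 𝒜] [Abelian 𝒜]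

/-- `f` and `g` form a short exact sequence. -/
def IsSES {A B C : 𝒜} (f : A ⟶ B) (g : B ⟶ C) : Prop :=
  ∃ w : f ≫ g = 0, (ShortComplex.mk f g w).ShortExact

namespace IsSES

variable {A B C : 𝒜} {f : A ⟶ B} {g : B ⟶ C}

lemma zero (h : IsSES f g) : f ≫ g = 0 := h.1

lemma mono (h : IsSES f g) : Mono f := h.2.mono_f

lemma epi (h : IsSES f g) : Epi g := h.2.epi_g

lemma exists_lift (h : IsSES f g) {D : 𝒜} (t : D ⟶ B) (ht : t ≫ g = 0) :
    ∃ s : D ⟶ A, s ≫ f = t :=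
  have := h.2.mono_f
  ⟨h.2.exact.lift t ht, h.2.exact.lift_f t ht⟩

lemma exists_desc (h : IsSES f g) {D : 𝒜} (t : B ⟶ D) (ht : f ≫ t = 0) :
    ∃ s : C ⟶ D, g ≫ s = t :=
  have := h.2.epi_g
  ⟨h.2.exact.desc t ht, h.2.exact.g_desc t ht⟩

lemma of_lift (w : f ≫ g = 0) (hf : Mono f) (hg : Epi g)
    (h : ∀ ⦃D : 𝒜⦄ (t : D ⟶ B), t ≫ g = 0 → ∃ s : D ⟶ A, s ≫ f = t) : IsSES f g := by
  refine ⟨w, ShortComplex.ShortExact.mk' ?_ hf hg⟩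
  rw [ShortComplex.exact_iff_exact_up_to_refinements]
  intro D t ht
  obtain ⟨s, hs⟩ := h t ht
  exact ⟨D, 𝟙 D, inferInstance, s, by simpa using hs.symm⟩

lemma of_lift_up_to_refinements (w : f ≫ g = 0) (hf : Mono f) (hg : Epi g)
    (h : ∀ ⦃D : 𝒜⦄ (t : D ⟶ B), t ≫ g = 0 →
      ∃ (D' : 𝒜) (π : D' ⟶ D) (_ : Epi π) (s : D' ⟶ A), π ≫ t = s ≫ f) : IsSES f g := by
  refine ⟨w, ShortComplex.ShortExact.mk' ?_ hf hg⟩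
  rw [ShortComplex.exact_iff_exact_up_to_refinements]
  exact fun D t ht => h t ht

lemma of_epi (g : B ⟶ C) [Epi g] : IsSES (kernel.ι g) g :=
  of_lift (kernel.condition g) inferInstance inferInstance
    fun _ t ht => ⟨kernel.lift g t ht, by simp⟩

lemma of_mono (f : A ⟶ B) [Mono f] : IsSES f (cokernel.π f) :=
  ⟨cokernel.condition f, ShortComplex.ShortExact.mk' (ShortComplex.exact_cokernel f)
    inferInstance inferInstance⟩

lemma of_isPullback (h : IsSES f g) {D E : 𝒜} {g' : E ⟶ D} {h' : E ⟶ B} {k : D ⟶ C}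
    (sq : IsPullback g' h' k g) : ∃ f' : A ⟶ E, f' ≫ h' = f ∧ IsSES f' g' := by
  have := h.mono
  have := h.epi
  refine ⟨sq.lift 0 f (by simp [h.zero]), by simp, of_lift (by simp) ?_ ?_ ?_⟩
  · have : Mono (sq.lift 0 f (by simp [h.zero]) ≫ h') := by simpa
    exact mono_of_mono _ h'
  · exact Abelian.epi_fst_of_isLimit _ _ sq.isLimit
  · intro T t ht
    obtain ⟨s, hs⟩ := h.exists_lift (t ≫ h') (by
      rw [Category.assoc, ← sq.w, reassoc_of% ht, zero_comp])
    exact ⟨s, sq.hom_ext (by simp [ht]) (by simp [hs])⟩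

lemma of_iso_left (h : IsSES f g) {A' : 𝒜} (e : A' ≅ A) : IsSES (e.hom ≫ f) g := by
  have := h.mono
  refine of_lift (by simp [h.zero]) inferInstance h.epi fun T t ht => ?_
  obtain ⟨s, hs⟩ := h.exists_lift t ht
  exact ⟨s ≫ e.inv, by simpa⟩

lemma of_iso_right (h : IsSES f g) {C' : 𝒜} (e : C ≅ C') : IsSES f (g ≫ e.hom) := by
  have := h.epi
  refine of_lift (by simp [reassoc_of% h.zero]) h.mono inferInstance fun T t ht => ?_
  exact h.exists_lift t (by simpa [← Category.assoc] using ht)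

/-- The kernel of a composite of epimorphisms is an extension of the kernels. -/
lemma comp_epi {D L : 𝒜} {q : C ⟶ D} {l : L ⟶ C} (h : IsSES f g) (h' : IsSES l q) :
    ∃ (N : 𝒜) (a : A ⟶ N) (b : N ⟶ L) (c : N ⟶ B), IsSES a b ∧ IsSES c (g ≫ q) := by
  have := h.epi
  have := h'.epi
  have := h'.mono
  have sq := IsPullback.of_hasPullback l g
  obtain ⟨a, -, ha⟩ := h.of_isPullback sq
  refine ⟨_, a, _, pullback.snd l g, ha, of_lift ?_ inferInstance inferInstance ?_⟩
  · rw [← Category.assoc, ← sq.w, Category.assoc, h'.zero, comp_zero]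
  · intro T t ht
    obtain ⟨s, hs⟩ := h'.exists_lift (t ≫ g) (by simpa using ht)
    exact ⟨pullback.lift s t hs, pullback.lift_snd _ _ _⟩

/-- Kernels of an epimorphism of short exact sequences. -/
lemma kernel_row {A' B' C' : 𝒜} {f' : A' ⟶ B'} {g' : B' ⟶ C'} (h : IsSES f g)
    (h' : IsSES f' g') (a : A ⟶ A') (b : B ⟶ B') (c : C ⟶ C') (hf : a ≫ f' = f ≫ b)
    (hg : b ≫ g' = g ≫ c) [Epi a] {Ka Kb Kc : 𝒜} {ka : Ka ⟶ A} {kb : Kb ⟶ B} {kc : Kc ⟶ C}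
    (ha : IsSES ka a) (hb : IsSES kb b) (hc : IsSES kc c) :
    ∃ (i : Ka ⟶ Kb) (p : Kb ⟶ Kc), IsSES i p := by
  have := h.mono
  have := h'.mono
  have := ha.mono
  have := hb.mono
  have := hc.mono
  have := h.epi
  obtain ⟨i, hi⟩ := hb.exists_lift (ka ≫ f) (by rw [Category.assoc, ← hf, reassoc_of% ha.zero,
    zero_comp])
  obtain ⟨p, hp⟩ := hc.exists_lift (kb ≫ g) (by rw [Category.assoc, ← hg, reassoc_of% hb.zero,
    zero_comp])
  have hmono : Mono i := by
    have : Mono (i ≫ kb) := by rw [hi]; infer_instance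
    exact mono_of_mono i kb
  refine ⟨i, p, of_lift ?_ hmono ?_ ?_⟩
  · rw [← cancel_mono kc, Category.assoc, hp, reassoc_of% hi, h.zero, comp_zero, zero_comp]
  · rw [epi_iff_surjective_up_to_refinements]
    intro T y
    -- Snake argument: a lift `x` of `y` has image under `b` in `A'`; surjectivity of `a` lets an
    -- element of `A` correct `x` into the kernel of `b`.
    obtain ⟨T₁, π₁, _, x, hx⟩ := surjective_up_to_refinements_of_epi g (y ≫ kc)
    obtain ⟨z, hz⟩ := h'.exists_lift (x ≫ b) (by
      rw [Category.assoc, hg, ← reassoc_of% hx, hc.zero, comp_zero, comp_zero])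
    obtain ⟨T₂, π₂, _, z', hz'⟩ := surjective_up_to_refinements_of_epi a z
    obtain ⟨s, hs⟩ := hb.exists_lift (π₂ ≫ x - z' ≫ f) (by
      rw [Preadditive.sub_comp, Category.assoc, Category.assoc, ← hf, ← hz, reassoc_of% hz',
        sub_self])
    refine ⟨T₂, π₂ ≫ π₁, inferInstance, s, ?_⟩
    rw [← cancel_mono kc, Category.assoc s, hp, ← Category.assoc s, hs, Preadditive.sub_comp]
    simp [h.zero, hx]
  · intro T t ht
    obtain ⟨s, hs⟩ := h.exists_lift (t ≫ kb) (by
      rw [Category.assoc, ← hp, reassoc_of% ht, zero_comp])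
    obtain ⟨s', hs'⟩ := ha.exists_lift s (by
      rw [← cancel_mono f', Category.assoc, hf, reassoc_of% hs, hb.zero, comp_zero, zero_comp])
    exact ⟨s', by rw [← cancel_mono kb, Category.assoc, hi, reassoc_of% hs', hs]⟩

lemma op (h : IsSES f g) : IsSES g.op f.op :=
  ⟨by rw [← op_comp, h.zero, op_zero], h.2.op⟩

lemma unop {A B C : 𝒜ᵒᵖ} {f : A ⟶ B} {g : B ⟶ C} (h : IsSES f g) : IsSES g.unop f.unop :=
  ⟨by rw [← unop_comp, h.zero, unop_zero], h.2.unop⟩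

/-- Cokernels of a monomorphism of short exact sequences. -/
lemma cokernel_row {A' B' C' : 𝒜} {f' : A' ⟶ B'} {g' : B' ⟶ C'} (h : IsSES f g)
    (h' : IsSES f' g') (a : A ⟶ A') (b : B ⟶ B') (c : C ⟶ C') (hf : a ≫ f' = f ≫ b)
    (hg : b ≫ g' = g ≫ c) [Mono c] {Qa Qb Qc : 𝒜} {qa : A' ⟶ Qa} {qb : B' ⟶ Qb} {qc : C' ⟶ Qc}
    (ha : IsSES a qa) (hb : IsSES b qb) (hc : IsSES c qc) :
    ∃ (i : Qa ⟶ Qb) (p : Qb ⟶ Qc), IsSES i p := by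
  obtain ⟨i, p, h⟩ := h'.op.kernel_row h.op c.op b.op a.op congr(($hg).op).symm
    congr(($hf).op).symm hc.op hb.op ha.op
  exact ⟨p.unop, i.unop, h.unop⟩

lemma biprod (A B : 𝒜) : IsSES (biprod.inl : A ⟶ A ⊞ B) (biprod.snd : A ⊞ B ⟶ B) :=
  of_lift (by simp) inferInstance inferInstance fun T t ht =>
    ⟨t ≫ biprod.fst, by ext <;> simp [ht]⟩

/-- The horseshoe lemma, one step. -/
lemma horseshoe (h : IsSES f g) {A' C' Ka Kc : 𝒜} {ka : Ka ⟶ A'} {a : A' ⟶ A}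
    {kc : Kc ⟶ C'} {c : C' ⟶ C} (ha : IsSES ka a) (hc : IsSES kc c) (hC' : Projective C') :
    ∃ (N : 𝒜) (i : Ka ⟶ N) (p : N ⟶ Kc) (k : N ⟶ A' ⊞ C') (b : A' ⊞ C' ⟶ B),
      IsSES i p ∧ IsSES k b := by
  have := h.epi
  have := ha.epi
  have := hc.epi
  have := h.mono
  let t : C' ⟶ B := Projective.factorThru c g
  have ht : t ≫ g = c := Projective.factorThru_comp c g
  let b := biprod.desc (a ≫ f) t
  have hb : Epi b := by
    rw [epi_iff_surjective_up_to_refinements]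
    intro T y
    obtain ⟨T₁, π₁, _, x, hx⟩ := surjective_up_to_refinements_of_epi c (y ≫ g)
    obtain ⟨z, hz⟩ := h.exists_lift (π₁ ≫ y - x ≫ t) (by
      simp [ht, hx])
    obtain ⟨T₂, π₂, _, z', hz'⟩ := surjective_up_to_refinements_of_epi a z
    refine ⟨T₂, π₂ ≫ π₁, inferInstance, biprod.lift z' (π₂ ≫ x), ?_⟩
    simp only [b, biprod.lift_desc]
    rw [← reassoc_of% hz', hz]
    simp
  obtain ⟨i, p, hip⟩ := (IsSES.biprod A' C').kernel_row h a b c (by simp [b])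
    (by ext <;> simp [b, ht, h.zero]) ha (of_epi b) hc
  exact ⟨_, i, p, _, b, hip, of_epi b⟩

end IsSES

end

/-! ### `Ext¹`-orthogonality to projectives and construction of totally acyclic complexes -/

section

variable {𝒜 : Type u} [Category.{v} 𝒜] [Abelian 𝒜]

/-- Objects `C` with `Ext¹(C, Q) = 0` for all projective `Q`: morphisms into projectives extend
along monomorphisms with cokernel `C`. -/
def OrthProj (C : 𝒜) : Prop :=
  ∀ ⦃A B : 𝒜⦄ (f : A ⟶ B) (g : B ⟶ C), IsSES f g → ∀ ⦃Q : 𝒜⦄, Projective Q →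
    ∀ φ : A ⟶ Q, ∃ ψ : B ⟶ Q, f ≫ ψ = φ

/-- Pull the sequence back along the retraction `G ⟶ A` and extend there; the section `A ⟶ G`
induces a section `B ⟶ E` of the pullback projection, along which the extension restricts. -/
lemma OrthProj.of_retract {A G : 𝒜} (hG : OrthProj G) (r : Retract A G) : OrthProj A := by
  intro K B f g h Q hQ φ
  have sq := IsPullback.of_hasPullback r.r g
  obtain ⟨f', hf', h'⟩ := h.of_isPullback sq
  obtain ⟨ψ, hψ⟩ := hG _ _ h' hQ φ
  refine ⟨sq.lift (g ≫ r.i) (𝟙 B) (by simp) ≫ ψ, ?_⟩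
  rw [← hψ, ← Category.assoc]
  congr 1
  apply sq.hom_ext
  · simp [reassoc_of% h.zero, h'.zero]
  · simp [hf']

/-- A morphism extends in two stages: to the preimage of `G` in `B`, with quotient `G`, and from
there to `B`, with quotient `H`. -/
lemma OrthProj.extension {G X H : 𝒜} {i : G ⟶ X} {p : X ⟶ H} (h : IsSES i p)
    (hG : OrthProj G) (hH : OrthProj H) : OrthProj X := by
  intro A B f g hfg Q hQ φ
  have sq := IsPullback.of_hasPullback i g
  obtain ⟨f', hf', h'⟩ := hfg.of_isPullback sq
  obtain ⟨ψ, hψ⟩ := hG _ _ h' hQ φ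
  have := hfg.epi
  have := h.epi
  have := h.mono
  have h2 : IsSES (pullback.snd i g) (g ≫ p) := by
    refine IsSES.of_lift ?_ inferInstance inferInstance fun T t ht => ?_
    · rw [← Category.assoc, ← sq.w, Category.assoc, h.zero, comp_zero]
    · obtain ⟨s, hs⟩ := h.exists_lift (t ≫ g) (by rw [Category.assoc, ht])
      exact ⟨pullback.lift s t hs, pullback.lift_snd _ _ _⟩
  obtain ⟨χ, hχ⟩ := hH _ _ h2 hQ ψ
  exact ⟨χ, by rw [← hψ, ← hχ, ← reassoc_of% hf']⟩

/-- It suffices to test the extension property on one projective presentation. -/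
lemma OrthProj.of_presentation {K P C : 𝒜} {k : K ⟶ P} {p : P ⟶ C} (h : IsSES k p)
    (hP : Projective P)
    (H : ∀ ⦃Q : 𝒜⦄, Projective Q → ∀ φ : K ⟶ Q, ∃ ψ : P ⟶ Q, k ≫ ψ = φ) : OrthProj C := by
  intro A B f g hfg Q hQ φ
  have := hfg.epi
  have := h.epi
  have := hfg.mono
  let t : P ⟶ B := Projective.factorThru p g
  have ht : t ≫ g = p := Projective.factorThru_comp p g
  obtain ⟨s, hs⟩ := hfg.exists_lift (k ≫ t) (by rw [Category.assoc, ht, h.zero])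
  obtain ⟨ψ, hψ⟩ := H hQ (s ≫ φ)
  -- `B` is the pushout of `A` and `P` over `K`, so `φ` and `ψ`, which agree on `K`, glue.
  have hb : IsSES (biprod.lift s (-k)) (biprod.desc f t) := by
    have := h.mono
    refine IsSES.of_lift (by simp [hs]) ?_ ?_ fun T x hx => ?_
    · have : Mono (biprod.lift s (-k) ≫ biprod.snd) := by
        rw [biprod.lift_snd]; infer_instance
      exact mono_of_mono _ biprod.snd
    · rw [epi_iff_surjective_up_to_refinements]
      intro T y
      obtain ⟨T₁, π₁, _, x, hx⟩ := surjective_up_to_refinements_of_epi p (y ≫ g)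
      obtain ⟨z, hz⟩ := hfg.exists_lift (π₁ ≫ y - x ≫ t) (by simp [ht, hx])
      exact ⟨T₁, π₁, inferInstance, biprod.lift z x, by simp [hz]⟩
    · have hx' : (x ≫ biprod.fst) ≫ f + (x ≫ biprod.snd) ≫ t = 0 := by
        rw [← hx, biprod.desc_eq]
        simp
      have hx2 := congr($hx' ≫ g)
      obtain ⟨y, hy⟩ := h.exists_lift (-(x ≫ biprod.snd)) (by
        simpa [hfg.zero, ht] using hx2)
      refine ⟨y, ?_⟩
      ext
      · rw [← cancel_mono f]
        have : y ≫ k ≫ t = (x ≫ biprod.fst) ≫ f := by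
          rw [reassoc_of% hy, eq_comm, Preadditive.neg_comp]
          exact eq_neg_of_add_eq_zero_left hx'
        simpa [hs] using this
      · simp [hy]
  obtain ⟨χ, hχ⟩ := hb.exists_desc (biprod.desc φ ψ) (by simp [hψ])
  refine ⟨χ, ?_⟩
  have := congr(biprod.inl ≫ $hχ)
  simpa using this

/-- Classes of objects that embed into and are covered by projectives with the (co)kernel again in
the class, and that are `Ext¹`-orthogonal to the projectives. -/
structure IsGPClass (X : ObjectProperty 𝒜) : Prop where
  right : ∀ A, X A → ∃ (P C : 𝒜) (i : A ⟶ P) (p : P ⟶ C), Projective P ∧ X C ∧ IsSES i p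
  left : ∀ A, X A → ∃ (P C : 𝒜) (i : C ⟶ P) (p : P ⟶ A), Projective P ∧ X C ∧ IsSES i p
  orth : ∀ A, X A → OrthProj A

/-- The chain of objects that splices to a totally acyclic complex. -/
lemma IsGPClass.exists_chain {X : ObjectProperty 𝒜} (hX : IsGPClass X) (A : 𝒜) (hA : X A) :
    ∃ Z : ℤ → 𝒜, Z 1 = A ∧ (∀ n, X (Z n)) ∧
      ∀ n, ∃ (P : 𝒜) (i : Z n ⟶ P) (p : P ⟶ Z (n + 1)), Projective P ∧ IsSES i p := by
  choose r hr using fun A : Subtype X => hX.right A.1 A.2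
  choose r' i' p' hr using hr
  choose l hl using fun A : Subtype X => hX.left A.1 A.2
  choose l' i'' p'' hl using hl
  let R : ℕ → Subtype X := fun n => n.rec ⟨A, hA⟩ fun _ B => ⟨r' B, (hr B).2.1⟩
  let L : ℕ → Subtype X := fun n => n.rec ⟨A, hA⟩ fun _ B => ⟨l' B, (hl B).2.1⟩
  let Z : ℤ → Subtype X := fun n => Int.rec (fun n => R n) (fun n => L (n + 1)) n
  have key : ∀ n m : ℤ, n + 1 = m → ∃ (P : 𝒜) (i : (Z n).1 ⟶ P) (p : P ⟶ (Z m).1),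
      Projective P ∧ IsSES i p := by
    rintro (n | n) m rfl
    · exact ⟨r (R n), i' _, p' (R n), (hr _).1, (hr (R n)).2.2⟩
    · have : Z (Int.negSucc n + 1) = L n := by
        cases n with
        | zero => rfl
        | succ n => rfl
      rw [this]
      exact ⟨l (L n), i'' (L n), p'' _, (hl _).1, (hl (L n)).2.2⟩
  -- The shift puts `A` at index 1, because the cokernel of the differential from degree -1 to
  -- degree 0 is the quotient of the term in degree 0.
  exact ⟨fun n => (Z (n - 1)).1, rfl, fun n => (Z _).2, fun n => key _ _ (by ring)⟩

/-- Splicing the chain gives an acyclic complex of projectives; orthogonality of its cycles makes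
`Hom` into a projective exact. -/
lemma IsGPClass.le_GProj {X : ObjectProperty 𝒜} (hX : IsGPClass X) : X ≤ GProj 𝒜 := by
  intro A hA
  obtain ⟨Z, rfl, hZ, h⟩ := hX.exists_chain A hA
  choose P i p hP hip using h
  let d : ∀ n, P n ⟶ P (n + 1) := fun n => p n ≫ i (n + 1)
  have hd : ∀ n, d n ≫ d (n + 1) = 0 := fun n => by simp [d, reassoc_of% (hip (n + 1)).zero]
  let K : CochainComplex 𝒜 ℤ := CochainComplex.of P d hd
  have hKd : ∀ n, K.d n (n + 1) = d n := fun n => CochainComplex.of_d _ _ _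
  have hepi := fun n => (hip n).epi
  have hmono := fun n => (hip n).mono
  refine ⟨K, ⟨hP, fun j => ?_, fun Q hQ j => ?_⟩, ⟨?_⟩⟩
  · obtain ⟨n, rfl⟩ : ∃ n, j = n + 1 := ⟨j - 1, by ring⟩
    rw [K.exactAt_iff' n (n + 1) (n + 1 + 1) (by simp) (by simp)]
    have : (ShortComplex.mk (d n) (d (n + 1)) (hd n)).Exact := by
      rw [ShortComplex.exact_iff_exact_up_to_refinements]
      intro T x hx
      dsimp only at x hx
      obtain ⟨s, hs⟩ := (hip (n + 1)).exists_lift x (by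
        rw [← cancel_mono (i (n + 1 + 1)), Category.assoc, hx, zero_comp])
      obtain ⟨T', π, _, y, hy⟩ := surjective_up_to_refinements_of_epi (p n) s
      exact ⟨T', π, inferInstance, y, by simp [d, ← reassoc_of% hy, hs]⟩
    convert this using 1
    simp only [HomologicalComplex.sc', HomologicalComplex.shortComplexFunctor', hKd]
  · obtain ⟨n, rfl⟩ : ∃ n, j = n + 1 := ⟨j - 1, by ring⟩
    have hn : n + 1 - 1 = n := by ring
    rw [hn, hKd, hKd]
    intro f
    constructor
    · intro hf
      change (p n ≫ i (n + 1)) ≫ f = 0 at hf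
      obtain ⟨s, hs⟩ := (hip (n + 1)).exists_desc f (by
        rw [← cancel_epi (p n), ← Category.assoc, hf, comp_zero])
      -- A cocycle factors through the quotient `Z (n + 2)`; it is a coboundary once this factor
      -- extends to `P (n + 2)`.
      obtain ⟨ψ, hψ⟩ := hX.orth _ (hZ _) _ _ (hip (n + 1 + 1)) hQ s
      exact ⟨ψ, by simp [d, hψ, hs]⟩
    · rintro ⟨g, rfl⟩
      change d n ≫ d (n + 1) ≫ g = 0
      rw [reassoc_of% hd n, zero_comp]
  · have h0 : IsSES (i 0) (p 0) := hip 0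
    let e : Z 1 ≅ cokernel (i 0) :=
      h0.2.gIsCokernel.coconePointUniqueUpToIso (colimit.isColimit _)
    exact e ≪≫ (cokernelEpiComp (p (-1)) (i 0)).symm ≪≫ cokernelIsoOfEq (hKd (-1)).symm

end

/-! ### Gorenstein-projectives form a resolving class closed under summands -/

section

variable {𝒜 : Type u} [Category.{v} 𝒜] [Abelian 𝒜]

lemma IsTotallyAcyclic.isSES {K : CochainComplex 𝒜 ℤ} (hK : IsTotallyAcyclic K)
    {a b c : ℤ} (hab : a + 1 = b) (hbc : b + 1 = c) : ∃ i : cokernel (K.d a b) ⟶ K.X c,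
      cokernel.π _ ≫ i = K.d b c ∧ IsSES i (cokernel.π (K.d b c)) := by
  have hex := (K.exactAt_iff' a b c (by simp [← hab]) (by simp [hbc])).1 (hK.acyclic b)
  have := hex.mono_cokernelDesc
  let i : cokernel (K.d a b) ⟶ K.X c := cokernel.desc (K.d a b) (K.d b c) (by simp)
  have hi : cokernel.π _ ≫ i = K.d b c := by simp [i]
  have : Mono i := this
  refine ⟨i, hi, IsSES.of_lift_up_to_refinements ?_ this inferInstance fun T x hx => ?_⟩
  · rw [← cancel_epi (cokernel.π (K.d a b)), reassoc_of% hi]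
    simp
  · obtain ⟨T', π, _, y, hy⟩ :=
      (ShortComplex.exact_cokernel (K.d b c)).exact_up_to_refinements x hx
    refine ⟨T', π, inferInstance, y ≫ cokernel.π (K.d a b), ?_⟩
    rw [hy, Category.assoc, hi]

/-- The class of the cokernels of the differentials of a totally acyclic complex. -/
lemma IsTotallyAcyclic.isGPClass {K : CochainComplex 𝒜 ℤ} (hK : IsTotallyAcyclic K) :
    IsGPClass fun A => ∃ a b : ℤ, a + 1 = b ∧ Nonempty (A ≅ cokernel (K.d a b)) where
  right := by
    rintro A ⟨a, b, hab, ⟨e⟩⟩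
    obtain ⟨i, -, hi⟩ := hK.isSES hab rfl
    exact ⟨_, _, _, _, hK.projective _, ⟨b, b + 1, rfl, ⟨Iso.refl _⟩⟩, hi.of_iso_left e⟩
  left := by
    rintro A ⟨b, c, hbc, ⟨e⟩⟩
    obtain ⟨i, -, hi⟩ := hK.isSES (a := b - 1) (by simp) hbc
    exact ⟨_, _, _, _, hK.projective _, ⟨_, b, by simp, ⟨Iso.refl _⟩⟩, hi.of_iso_right e.symm⟩
  orth := by
    rintro A ⟨b, c, rfl, ⟨e⟩⟩
    obtain ⟨i, hi', hi⟩ := hK.isSES (a := b - 1) (by simp) (rfl : b + 1 = _)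
    refine OrthProj.of_presentation (hi.of_iso_right e.symm) (hK.projective _) ?_
    intro Q hQ φ
    -- A morphism out of a cokernel is a cocycle of `Hom(K, Q)`; writing it as a coboundary extends
    -- it to the next projective.
    obtain ⟨ψ, hψ⟩ := (hK.hom_acyclic Q hQ b (cokernel.π _ ≫ φ)).1 (by simp)
    exact ⟨ψ, by rw [← cancel_epi (cokernel.π (K.d (b - 1) b)), ← hψ, reassoc_of% hi']⟩

variable (𝒜) in
lemma isGPClass_GProj : IsGPClass (GProj 𝒜) where
  right := by
    rintro A ⟨K, hK, ⟨e⟩⟩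
    obtain ⟨P, C, i, p, hP, hC, h⟩ := hK.isGPClass.right A ⟨-1, 0, rfl, ⟨e⟩⟩
    exact ⟨P, C, i, p, hP, hK.isGPClass.le_GProj _ hC, h⟩
  left := by
    rintro A ⟨K, hK, ⟨e⟩⟩
    obtain ⟨P, C, i, p, hP, hC, h⟩ := hK.isGPClass.left A ⟨-1, 0, rfl, ⟨e⟩⟩
    exact ⟨P, C, i, p, hP, hK.isGPClass.le_GProj _ hC, h⟩
  orth := by
    rintro A ⟨K, hK, ⟨e⟩⟩
    exact hK.isGPClass.orth A ⟨-1, 0, rfl, ⟨e⟩⟩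

open ZeroObject in
lemma GProj_of_projective (A : 𝒜) (hA : Projective A) : GProj 𝒜 A := by
  have h0 : ∀ B : 𝒜, IsSES (𝟙 B) (0 : B ⟶ 0) := fun B =>
    IsSES.of_lift (by simp) inferInstance inferInstance fun T t _ => ⟨t, by simp⟩
  have h1 : ∀ B : 𝒜, IsSES (0 : 0 ⟶ B) (𝟙 B) := fun B =>
    IsSES.of_lift (by simp) inferInstance inferInstance fun T t ht =>
      ⟨0, by simpa using ht.symm⟩
  have hz : Projective (0 : 𝒜) := inferInstance
  refine IsGPClass.le_GProj (X := fun B => Projective B) ⟨?_, ?_, ?_⟩ A hA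
  · exact fun B hB => ⟨B, 0, _, _, hB, hz, h0 B⟩
  · exact fun B hB => ⟨B, 0, _, _, hB, hz, h1 B⟩
  · exact fun B hB => OrthProj.of_presentation (h1 B) hB
      fun Q hQ φ => ⟨0, (isZero_zero 𝒜).eq_of_src _ _⟩

/-- The extensions of Gorenstein-projectives satisfy the criterion: projective covers of the ends
combine by the horseshoe lemma, and the dual construction works because `OrthProj H` extends `G ⟶ P`
to `X`. -/
lemma GProj_extension {G X H : 𝒜} {i : G ⟶ X} {p : X ⟶ H} (h : IsSES i p)
    (hG : GProj 𝒜 G) (hH : GProj 𝒜 H) : GProj 𝒜 X := by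
  have gp := isGPClass_GProj 𝒜
  refine IsGPClass.le_GProj (X := fun X => ∃ (G H : 𝒜) (i : G ⟶ X) (p : X ⟶ H),
    GProj 𝒜 G ∧ GProj 𝒜 H ∧ IsSES i p) ⟨?_, ?_, ?_⟩ X ⟨G, H, i, p, hG, hH, h⟩
  · rintro X ⟨G, H, i, p, hG, hH, h⟩
    obtain ⟨P, G', j, q, hP, hG', hj⟩ := gp.right G hG
    obtain ⟨P', H', j', q', hP', hH', hj'⟩ := gp.right H hH
    obtain ⟨t, ht⟩ := gp.orth H hH _ _ h hP j
    have := hj.mono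
    have := hj'.mono
    have hb : Mono (biprod.lift t (p ≫ j')) := by
      refine Preadditive.mono_of_cancel_zero _ fun x hx => ?_
      have h1 : x ≫ t = 0 := by simpa using congr($hx ≫ biprod.fst)
      have h2 : x ≫ p = 0 := by
        rw [← cancel_mono j']; simpa using congr($hx ≫ biprod.snd)
      obtain ⟨y, rfl⟩ := h.exists_lift x h2
      rw [Category.assoc, ht] at h1
      rw [(cancel_mono j).1 (h1.trans zero_comp.symm), zero_comp]
    obtain ⟨i', p', h'⟩ := h.cokernel_row (IsSES.biprod P P') j (biprod.lift t (p ≫ j')) j'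
      (by ext <;> simp [ht, reassoc_of% h.zero]) (by simp) hj (IsSES.of_mono _) hj'
    exact ⟨_, _, _, _, inferInstance, ⟨_, _, _, _, hG', hH', h'⟩, IsSES.of_mono _⟩
  · rintro X ⟨G, H, i, p, hG, hH, h⟩
    obtain ⟨P, G', j, q, hP, hG', hj⟩ := gp.left G hG
    obtain ⟨P', H', j', q', hP', hH', hj'⟩ := gp.left H hH
    obtain ⟨N, i', p', k, b, hN, hb⟩ := h.horseshoe hj hj' hP'
    exact ⟨_, N, k, b, inferInstance, ⟨_, _, _, _, hG', hH', hN⟩, hb⟩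
  · rintro X ⟨G, H, i, p, hG, hH, h⟩
    exact OrthProj.extension h (gp.orth G hG) (gp.orth H hH)

/-- The cosyzygy and syzygy of `A` obtained through `G` become Gorenstein-projective after adding
`A`, so they are again summands of Gorenstein-projectives. -/
lemma GProj_of_retract {A G : 𝒜} (r : Retract A G) (hG : GProj 𝒜 G) : GProj 𝒜 A := by
  have gp := isGPClass_GProj 𝒜
  refine IsGPClass.le_GProj (X := fun A => ∃ G, GProj 𝒜 G ∧ Nonempty (Retract A G))
    ⟨?_, ?_, ?_⟩ A ⟨G, hG, ⟨r⟩⟩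
  · rintro A ⟨G, hG, ⟨r⟩⟩
    obtain ⟨P, G', j, q, hP, hG', hj⟩ := gp.right G hG
    have := hj.mono
    have := hj.epi
    let k := r.i ≫ j
    have hk : IsSES k (cokernel.π k) := IsSES.of_mono k
    obtain ⟨a, ha⟩ := hk.exists_desc q (by simp [k, hj.zero])
    -- If `G = A ⊕ A'`, then `P / A` is an extension of `P / G` by `A'`; adding `A` gives an
    -- extension of `P / G` by `G`, which can be written without the complement `A'`.
    have hses : IsSES (biprod.lift (j ≫ cokernel.π k) r.r) (biprod.fst ≫ a) := by
      refine IsSES.of_lift_up_to_refinements ?_ ?_ ?_ ?_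
      · simp [ha, hj.zero]
      · refine Preadditive.mono_of_cancel_zero _ fun x hx => ?_
        have h1 : x ≫ j ≫ cokernel.π k = 0 := by simpa using congr($hx ≫ biprod.fst)
        have h2 : x ≫ r.r = 0 := by simpa using congr($hx ≫ biprod.snd)
        obtain ⟨y, hy⟩ := hk.exists_lift (x ≫ j) (by simpa using h1)
        have hx' : x = y ≫ r.i := by rw [← cancel_mono j, ← hy, Category.assoc]
        rw [hx', Category.assoc, r.retract, Category.comp_id] at h2
        rw [hx', h2, zero_comp]
      · have : Epi (cokernel.π k ≫ a) := by rw [ha]; infer_instance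
        have := epi_of_epi (cokernel.π k) a
        infer_instance
      · intro T x hx
        obtain ⟨T₁, π, _, y, hy⟩ :=
          surjective_up_to_refinements_of_epi (cokernel.π k) (x ≫ biprod.fst)
        obtain ⟨z, hz⟩ := hj.exists_lift y (by
          rw [← ha, ← reassoc_of% hy]; simpa using congr(π ≫ $hx))
        refine ⟨T₁, π, inferInstance, z + (π ≫ x ≫ biprod.snd - z ≫ r.r) ≫ r.i, ?_⟩
        have hk0 : r.i ≫ j ≫ cokernel.π k = 0 :=
          (Category.assoc _ _ _).symm.trans hk.zero
        ext
        · simp [hy, ← hz, hk0]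
        · simp
    exact ⟨P, _, k, _, hP, ⟨_, GProj_extension hses hG hG', ⟨⟨biprod.inl, biprod.fst, by simp⟩⟩⟩,
      hk⟩
  · rintro A ⟨G, hG, ⟨r⟩⟩
    obtain ⟨P, G', j, q, hP, hG', hj⟩ := gp.left G hG
    have := hj.mono
    have := hj.epi
    have hk : IsSES (kernel.ι (q ≫ r.r)) (q ≫ r.r) := IsSES.of_epi _
    obtain ⟨a, ha⟩ := hk.exists_lift j (by simp [reassoc_of% hj.zero])
    have hk0 : kernel.ι (q ≫ r.r) ≫ q ≫ r.r = 0 := hk.zero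
    have hses : IsSES (a ≫ biprod.inl) (biprod.desc (kernel.ι (q ≫ r.r) ≫ q) r.i) := by
      refine IsSES.of_lift ?_ ?_ ?_ ?_
      · simp [reassoc_of% ha, hj.zero]
      · have : Mono (a ≫ kernel.ι (q ≫ r.r)) := by rw [ha]; infer_instance
        have := mono_of_mono a (kernel.ι (q ≫ r.r))
        infer_instance
      · rw [epi_iff_surjective_up_to_refinements]
        intro T y
        obtain ⟨T₁, π, _, z, hz⟩ :=
          surjective_up_to_refinements_of_epi q (y - y ≫ r.r ≫ r.i)
        obtain ⟨s, hs⟩ := hk.exists_lift z (by rw [← reassoc_of% hz]; simp)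
        refine ⟨T₁, π, inferInstance, biprod.lift s (π ≫ y ≫ r.r), ?_⟩
        rw [biprod.lift_desc, reassoc_of% hs, ← hz]
        simp
      · intro T x hx
        have hx' : (x ≫ biprod.fst) ≫ kernel.ι (q ≫ r.r) ≫ q + (x ≫ biprod.snd) ≫ r.i = 0 := by
          rw [← hx, biprod.desc_eq]
          simp
        have h2 : x ≫ biprod.snd = 0 := by
          simpa [hk0] using congr($hx' ≫ r.r)
        rw [h2, zero_comp, add_zero] at hx'
        obtain ⟨s, hs⟩ := hj.exists_lift ((x ≫ biprod.fst) ≫ kernel.ι (q ≫ r.r))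
          (by rw [Category.assoc, hx'])
        refine ⟨s, ?_⟩
        ext
        · simpa [ha] using hs
        · simp [h2]
    exact ⟨P, _, _, _, hP, ⟨_, GProj_extension hses hG' hG, ⟨⟨biprod.inl, biprod.fst, by simp⟩⟩⟩,
      hk⟩
  · rintro A ⟨G, hG, ⟨r⟩⟩
    exact (gp.orth G hG).of_retract r

/-- A short exact sequence ending in a projective object splits. -/
lemma IsSES.exists_retract {A B C : 𝒜} {f : A ⟶ B} {g : B ⟶ C} (h : IsSES f g)
    (hC : Projective C) : Nonempty (Retract A B) := by
  have := h.epi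
  have := h.mono
  obtain ⟨s, hs⟩ : ∃ s, s ≫ g = 𝟙 C := ⟨Projective.factorThru (𝟙 C) g, by simp⟩
  obtain ⟨r, hr⟩ := h.exists_lift (𝟙 B - g ≫ s) (by simp [hs])
  exact ⟨⟨f, r, by rw [← cancel_mono f, Category.assoc, hr]; simp [reassoc_of% h.zero]⟩⟩

variable (𝒜) in
lemma isResolving_GProj : IsResolving (GProj 𝒜) where
  projective := GProj_of_projective
  extension S hS h₁ h₃ := GProj_extension ⟨S.zero, hS⟩ h₁ h₃
  kernel S hS h₂ h₃ := by
    have h : IsSES S.f S.g := ⟨S.zero, hS⟩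
    obtain ⟨P, C, i, p, hP, hC, hp⟩ := (isGPClass_GProj 𝒜).left _ h₃
    -- The pullback is an extension of `S.X₂` by `C`, hence Gorenstein-projective, and `S.X₁` is a
    -- summand of it because its quotient by `S.X₁` is the projective `P`.
    have sq := IsPullback.of_hasPullback p S.g
    obtain ⟨_, -, h'⟩ := h.of_isPullback sq
    obtain ⟨_, -, hp'⟩ := hp.of_isPullback sq.flip
    obtain ⟨r⟩ := h'.exists_retract hP
    exact GProj_of_retract r (GProj_extension hp' hC h₂)

end

/-! ### Resolution dimension and dimension shifting -/

section

variable {𝒜 : Type u} [Category.{v} 𝒜] [Abelian 𝒜]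

namespace IsResolving

variable {X : ObjectProperty 𝒜}

lemma of_ses (hX : IsResolving X) {A B C : 𝒜} {f : A ⟶ B} {g : B ⟶ C} (h : IsSES f g)
    (hA : X A) (hC : X C) : X B :=
  hX.extension _ h.2 hA hC

lemma kernel_of_ses (hX : IsResolving X) {A B C : 𝒜} {f : A ⟶ B} {g : B ⟶ C} (h : IsSES f g)
    (hB : X B) (hC : X C) : X A :=
  hX.kernel _ h.2 hB hC

open ZeroObject in
lemma of_iso (hX : IsResolving X) {A B : 𝒜} (e : A ≅ B) (hA : X A) : X B := by
  refine hX.of_ses (f := e.hom) (g := (0 : B ⟶ 0)) ?_ hA (hX.projective 0 inferInstance)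
  exact IsSES.of_lift (by simp) inferInstance inferInstance fun T t _ => ⟨t ≫ e.inv, by simp⟩

lemma biprod (hX : IsResolving X) {A B : 𝒜} (hA : X A) (hB : X B) : X (A ⊞ B) :=
  hX.of_ses (IsSES.biprod A B) hA hB

end IsResolving

lemma hasResolution_zero_iff {X : ObjectProperty 𝒜} (hX : IsResolving X) {A : 𝒜} :
    HasResolution X 0 A ↔ X A :=
  ⟨fun ⟨_, h, ⟨e⟩⟩ => hX.of_iso e h, fun h => ⟨A, h, ⟨Iso.refl _⟩⟩⟩

lemma hasResolution_succ_iff {X : ObjectProperty 𝒜} {n : ℕ} {A : 𝒜} :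
    HasResolution X (n + 1) A ↔ ∃ (K X₀ : 𝒜) (i : K ⟶ X₀) (p : X₀ ⟶ A),
      IsSES i p ∧ X X₀ ∧ HasResolution X n K :=
  ⟨fun ⟨K, X₀, i, p, w, h⟩ => ⟨K, X₀, i, p, ⟨w, h.1⟩, h.2⟩,
    fun ⟨K, X₀, i, p, h, h'⟩ => ⟨K, X₀, i, p, h.1, h.2, h'⟩⟩

open ZeroObject in
lemma HasResolution.succ {X : ObjectProperty 𝒜} (hX : IsResolving X) {n : ℕ} {A : 𝒜}
    (h : HasResolution X n A) : HasResolution X (n + 1) A := by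
  induction n generalizing A with
  | zero =>
    refine hasResolution_succ_iff.2 ⟨0, A, 0, 𝟙 A, ?_, (hasResolution_zero_iff hX).1 h,
      (hasResolution_zero_iff hX).2 (hX.projective 0 inferInstance)⟩
    exact IsSES.of_lift (by simp) inferInstance inferInstance fun T t ht =>
      ⟨0, by simpa using ht.symm⟩
  | succ n ih =>
    obtain ⟨K, X₀, i, p, h, h₀, hK⟩ := hasResolution_succ_iff.1 h
    exact hasResolution_succ_iff.2 ⟨K, X₀, i, p, h, h₀, ih hK⟩

lemma HasResolution.of_le {X : ObjectProperty 𝒜} (hX : IsResolving X) {m n : ℕ} (hmn : m ≤ n)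
    {A : 𝒜} (h : HasResolution X m A) : HasResolution X n A := by
  induction hmn with
  | refl => exact h
  | step _ ih => exact ih.succ hX

lemma HasResolution.mono {X Y : ObjectProperty 𝒜} (hXY : X ≤ Y) {n : ℕ} {A : 𝒜}
    (h : HasResolution X n A) : HasResolution Y n A := by
  induction n generalizing A with
  | zero =>
    obtain ⟨X₀, h₀, e⟩ := h
    exact ⟨X₀, hXY _ h₀, e⟩
  | succ n ih =>
    obtain ⟨K, X₀, i, p, w, h, h₀, hK⟩ := h
    exact ⟨K, X₀, i, p, w, h, hXY _ h₀, ih hK⟩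

lemma resDim_mono {X Y : ObjectProperty 𝒜} (hXY : X ≤ Y) (A : 𝒜) : resDim Y A ≤ resDim X A :=
  le_iInf₂ fun n hn => iInf₂_le n (hn.mono hXY)

lemma catResDim_mono {X Y : ObjectProperty 𝒜} (hXY : X ≤ Y) : catResDim Y ≤ catResDim X :=
  iSup_mono (resDim_mono hXY)

lemma catResDim_lt_top_iff {X : ObjectProperty 𝒜} (hX : IsResolving X) :
    catResDim X < ⊤ ↔ ∃ n, ∀ A, HasResolution X n A := by
  constructor
  · intro h
    obtain ⟨n, hn⟩ := ENat.ne_top_iff_exists.1 h.ne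
    refine ⟨n, fun A => ?_⟩
    have hA : resDim X A < (n + 1 : ℕ) :=
      ((le_iSup (resDim X) A).trans_eq hn.symm).trans_lt (by exact_mod_cast Nat.lt_succ_self n)
    simp only [resDim, iInf_lt_iff] at hA
    obtain ⟨m, hm, hmn⟩ := hA
    exact hm.of_le hX (Nat.lt_succ_iff.1 (by exact_mod_cast hmn))
  · rintro ⟨n, hn⟩
    exact (iSup_le fun A => iInf₂_le n (hn A)).trans_lt (ENat.natCast_lt_top n)

/-- Only the zeroth term changes: the kernel of `X₀ ⟶ M ⟶ Y` lies in `X` and covers `L` with the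
same first syzygy `K`. -/
lemma HasResolution.kernel {X : ObjectProperty 𝒜} (hX : IsResolving X) {n : ℕ} {L M Y : 𝒜} {l : L ⟶ M}
    {q : M ⟶ Y} (h : IsSES l q) (hM : HasResolution X n M) (hY : X Y) : HasResolution X n L := by
  cases n with
  | zero =>
    rw [hasResolution_zero_iff hX] at hM ⊢
    exact hX.kernel_of_ses h hM hY
  | succ n =>
    obtain ⟨K, X₀, i, p, hp, h₀, hK⟩ := hasResolution_succ_iff.1 hM
    obtain ⟨N, a, b, c, hab, hc⟩ := hp.comp_epi h
    exact hasResolution_succ_iff.2 ⟨K, N, a, b, hab, hX.kernel_of_ses hc h₀ hY, hK⟩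

variable [EnoughProjectives 𝒜]

lemma exists_projective_presentation (A : 𝒜) :
    ∃ (K P : 𝒜) (k : K ⟶ P) (p : P ⟶ A), Projective P ∧ IsSES k p :=
  ⟨_, Projective.over A, _, Projective.π A, inferInstance, IsSES.of_epi _⟩

variable {X : ObjectProperty 𝒜}

lemma HasResolution.extension (hX : IsResolving X) {n : ℕ} {A B C : 𝒜} {f : A ⟶ B}
    {g : B ⟶ C} (h : IsSES f g) (hA : HasResolution X n A) (hC : X C) : HasResolution X n B := by
  induction n generalizing A B C with
  | zero =>
    rw [hasResolution_zero_iff hX] at hA ⊢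
    exact hX.of_ses h hA hC
  | succ n ih =>
    obtain ⟨K, X₀, i, p, hp, h₀, hK⟩ := hasResolution_succ_iff.1 hA
    obtain ⟨L, P, k, q, hP, hq⟩ := exists_projective_presentation C
    obtain ⟨N, i', p', k', b, hN, hb⟩ := h.horseshoe hp hq hP
    exact hasResolution_succ_iff.2 ⟨N, _, k', b, hb, hX.biprod h₀ (hX.projective P hP),
      ih hN hK (hX.kernel_of_ses hq (hX.projective P hP) hC)⟩

/-- Dimension shifting: the first syzygy with respect to any epimorphism from `X`. -/
lemma HasResolution.syzygy (hX : IsResolving X) {n : ℕ} {K X₀ C : 𝒜} {k : K ⟶ X₀}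
    {p : X₀ ⟶ C} (h : IsSES k p) (h₀ : X X₀) (hC : HasResolution X (n + 1) C) :
    HasResolution X n K := by
  obtain ⟨K', X', i, p', hp', h', hK'⟩ := hasResolution_succ_iff.1 hC
  -- Schanuel's argument: the pullback is an extension of `X₀` by `K'` and of `X'` by `K`, which
  -- transfers the bound from `K'` to `K`.
  have sq := IsPullback.of_hasPullback p p'
  obtain ⟨_, -, h1⟩ := hp'.of_isPullback sq
  obtain ⟨_, -, h2⟩ := h.of_isPullback sq.flip
  exact (hK'.extension hX h1 h₀).kernel hX h2 h'

lemma GProj_le_of_hasResolution (hX : IsResolving X) (n : ℕ)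
    (h : ∀ A, HasResolution X n A) : GProj 𝒜 ≤ X := by
  suffices ∀ k ≤ n, ∀ A, GProj 𝒜 A → HasResolution X (n - k) A by
    intro A hA
    have := this n le_rfl A hA
    rwa [Nat.sub_self, hasResolution_zero_iff hX] at this
  intro k
  induction k with
  | zero => exact fun _ A _ => h A
  | succ k ih =>
    intro hk A hA
    obtain ⟨P, C, i, p, hP, hC, hi⟩ := (isGPClass_GProj 𝒜).right A hA
    have := ih (by lia) C hC
    rw [show n - k = n - (k + 1) + 1 by lia] at this
    exact this.syzygy hX hi (hX.projective P hP)

lemma eq_GProj_of_catResDim_lt_top (hX : IsResolving X) (hle : X ≤ GProj 𝒜)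
    (h : catResDim X < ⊤) : X = GProj 𝒜 := by
  obtain ⟨n, hn⟩ := (catResDim_lt_top_iff hX).1 h
  exact le_antisymm hle (GProj_le_of_hasResolution hX n hn)

end

/-! ### Modules over the Auslander algebra and approximations -/

section

variable {𝒜 : Type u} [Category.{v} 𝒜] [Abelian 𝒜]

/-- Postcomposition as a map of modules over the Auslander algebra. -/
def postcomp (T : 𝒜) {A B : 𝒜} (p : A ⟶ B) : (T ⟶ A) →ₗ[AuslanderAlgebra T] (T ⟶ B) where
  toFun s := s ≫ p
  map_add' _ _ := Preadditive.add_comp _ _ _ _ _ _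
  map_smul' _ _ := Category.assoc _ _ _

@[simp]
lemma postcomp_apply (T : 𝒜) {A B : 𝒜} (p : A ⟶ B) (s : T ⟶ A) : postcomp T p s = s ≫ p := rfl

/-- `Hom(T, Tⁿ)` is a free module. -/
noncomputable def homPowerEquiv (T : 𝒜) (n : ℕ) :
    (T ⟶ ⨁ fun _ : Fin n => T) ≃ₗ[AuslanderAlgebra T] (Fin n → AuslanderAlgebra T) where
  toFun s i := MulOpposite.op (s ≫ biproduct.π (fun _ : Fin n => T) i)
  map_add' s t := by
    funext i
    exact congrArg MulOpposite.op (Preadditive.add_comp _ _ _ s t _)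
  map_smul' r s := by
    funext i
    exact congrArg MulOpposite.op (Category.assoc r.unop s _)
  invFun c := biproduct.lift fun i => (c i).unop
  left_inv s := by
    apply biproduct.hom_ext
    intro i
    exact biproduct.lift_π _ _
  right_inv c := by
    funext i
    exact congrArg MulOpposite.op (biproduct.lift_π _ i)

lemma exists_eq_postcomp {T B : 𝒜} {n : ℕ}
    (F : (T ⟶ ⨁ fun _ : Fin n => T) →ₗ[AuslanderAlgebra T] (T ⟶ B)) :
    ∃ φ : (⨁ fun _ : Fin n => T) ⟶ B, F = postcomp T φ := by
  refine ⟨biproduct.desc fun i => F (biproduct.ι (fun _ : Fin n => T) i), ?_⟩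
  ext s
  have hs : s = ∑ i, (MulOpposite.op (s ≫ biproduct.π (fun _ : Fin n => T) i) :
      AuslanderAlgebra T) • biproduct.ι (fun _ : Fin n => T) i := by
    have : s = s ≫ 𝟙 _ := (Category.comp_id s).symm
    rw [← biproduct.total, Preadditive.comp_sum] at this
    refine this.trans (Finset.sum_congr rfl fun i _ => ?_)
    exact (Category.assoc _ _ _).symm
  conv_lhs => rw [hs]
  rw [map_sum, postcomp_apply, biproduct.desc_eq, Preadditive.comp_sum]
  refine Finset.sum_congr rfl fun i _ => ?_
  rw [map_smul]
  exact Category.assoc _ _ _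

/-- Right `add T`-approximations of the objects of `𝒜`. -/
def HasApproximations (T : 𝒜) : Prop :=
  ∀ A : 𝒜, ∃ (n : ℕ) (p : (⨁ fun _ : Fin n => T) ⟶ A), Function.Surjective (postcomp T p)

/-- Finitely many `R`-generators of `Hom(T, A)` assemble to a map from a power of `T`; `R`-linear
combinations of the inclusions hit every morphism. -/
lemma hasApproximations_of_finite (R : Type w) [CommRing R] [Linear R 𝒜] (T : 𝒜)
    (h : ∀ A : 𝒜, Module.Finite R (T ⟶ A)) : HasApproximations T := by
  intro A
  have := h A
  obtain ⟨n, s, hs⟩ := Module.Finite.exists_fin (R := R) (M := T ⟶ A)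
  refine ⟨n, biproduct.desc s, fun t => ?_⟩
  obtain ⟨c, rfl⟩ := (Submodule.mem_span_range_iff_exists_fun R).1
    (hs ▸ Submodule.mem_top : t ∈ Submodule.span R (Set.range s))
  refine ⟨∑ i, c i • biproduct.ι (fun _ : Fin n => T) i, ?_⟩
  simp

lemma exists_comp_eq_of_addClosure {T B C A : 𝒜} {p : B ⟶ C}
    (hp : Function.Surjective (postcomp T p)) (hA : addClosure T A) (t : A ⟶ C) :
    ∃ s : A ⟶ B, s ≫ p = t := by
  obtain ⟨n, ⟨r⟩⟩ := hA
  choose s hs using fun i => hp (biproduct.ι (fun _ : Fin n => T) i ≫ r.r ≫ t)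
  refine ⟨r.i ≫ biproduct.desc s, ?_⟩
  have : biproduct.desc s ≫ p = r.r ≫ t := by
    apply biproduct.hom_ext'
    intro i
    simpa using hs i
  simp [this]

/-- `Hom(T, -)` is left exact. -/
lemma exact_postcomp {T A B C : 𝒜} {f : A ⟶ B} {g : B ⟶ C} (h : IsSES f g) :
    Function.Injective (postcomp T f) ∧ Function.Exact (postcomp T f) (postcomp T g) := by
  have := h.mono
  refine ⟨fun s t hst => (cancel_mono f).1 hst, fun t => ⟨h.exists_lift t, ?_⟩⟩
  rintro ⟨s, rfl⟩
  simp [h.zero]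

section Modules

variable {Γ : Type v} [Ring Γ] {M N L : Type v} [AddCommGroup M] [AddCommGroup N]
  [AddCommGroup L] [Module Γ M] [Module Γ N] [Module Γ L]

lemma shortExact_moduleCat {f : M →ₗ[Γ] N} {g : N →ₗ[Γ] L} (hf : Function.Injective f)
    (hfg : Function.Exact f g) (hg : Function.Surjective g) :
    (ShortComplex.mk (ModuleCat.ofHom f) (ModuleCat.ofHom g)
      (by ext x; exact hfg.apply_apply_eq_zero x)).ShortExact :=
  ModuleCat.shortComplex_shortExact _ hfg hf hg

lemma hasProjectiveDimensionLE_iff_of_exact {f : M →ₗ[Γ] N} {g : N →ₗ[Γ] L}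
    (hf : Function.Injective f) (hfg : Function.Exact f g) (hg : Function.Surjective g)
    [Module.Projective Γ N] (n : ℕ) :
    HasProjectiveDimensionLE (ModuleCat.of Γ L) (n + 1) ↔
      HasProjectiveDimensionLE (ModuleCat.of Γ M) n :=
  (shortExact_moduleCat hf hfg hg).hasProjectiveDimensionLT_X₃_iff n
    ((IsProjective.iff_projective N).1 inferInstance)

end Modules

instance projective_hom_power (T : 𝒜) (n : ℕ) :
    Module.Projective (AuslanderAlgebra T) (T ⟶ ⨁ fun _ : Fin n => T) :=
  Module.Projective.of_equiv (homPowerEquiv T n).symm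

instance finitePresentation_hom_power (T : 𝒜) (n : ℕ) :
    Module.FinitePresentation (AuslanderAlgebra T) (T ⟶ ⨁ fun _ : Fin n => T) :=
  Module.FinitePresentation.of_equiv (homPowerEquiv T n).symm

lemma projective_hom {T A : 𝒜} (hA : addClosure T A) :
    Module.Projective (AuslanderAlgebra T) (T ⟶ A) := by
  obtain ⟨n, ⟨r⟩⟩ := hA
  refine Module.Projective.of_split (postcomp T r.i) (postcomp T r.r) ?_
  ext s
  simp

/-- An approximation is an epimorphism when all projectives lie in `add T`. -/
lemma epi_of_surjective_postcomp [EnoughProjectives 𝒜] {T A B : 𝒜} {p : B ⟶ A}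
    (hp : Function.Surjective (postcomp T p)) (hX : IsResolving (addClosure T)) : Epi p := by
  obtain ⟨s, hs⟩ := exists_comp_eq_of_addClosure hp
    (hX.projective _ inferInstance) (Projective.π A)
  have : Epi (s ≫ p) := by rw [hs]; infer_instance
  exact epi_of_epi s p

lemma addClosure_power (T : 𝒜) (n : ℕ) : addClosure T (⨁ fun _ : Fin n => T) :=
  ⟨n, ⟨Retract.refl _⟩⟩

variable [EnoughProjectives 𝒜] {T : 𝒜}

/-- Dimension shifting permits replacing the given resolution by one built from approximations, on
which `Hom(T, -)` stays exact. -/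
lemma hasProjectiveDimensionLE_hom (hX : IsResolving (addClosure T)) (hT : HasApproximations T)
    {n : ℕ} {A : 𝒜} (h : HasResolution (addClosure T) n A) :
    HasProjectiveDimensionLE (ModuleCat.of (AuslanderAlgebra T) (T ⟶ A)) n := by
  induction n generalizing A with
  | zero =>
    have := projective_hom ((hasResolution_zero_iff hX).1 h)
    exact (projective_iff_hasProjectiveDimensionLE_zero _).1
      ((IsProjective.iff_projective (T ⟶ A)).1 inferInstance)
  | succ n ih =>
    obtain ⟨m, p, hp⟩ := hT A
    have := epi_of_surjective_postcomp hp hX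
    have hk := IsSES.of_epi p
    obtain ⟨h1, h2⟩ := exact_postcomp (T := T) hk
    exact (hasProjectiveDimensionLE_iff_of_exact h1 h2 hp n).2
      (ih (h.syzygy hX hk (addClosure_power T m)))

lemma hasResolution_of_hasProjectiveDimensionLE (hX : IsResolving (addClosure T))
    (hT : HasApproximations T) {n : ℕ} {A : 𝒜}
    (h : HasProjectiveDimensionLE (ModuleCat.of (AuslanderAlgebra T) (T ⟶ A)) n) :
    HasResolution (addClosure T) n A := by
  induction n generalizing A with
  | zero =>
    rw [hasResolution_zero_iff hX]
    have : Module.Projective (AuslanderAlgebra T) (T ⟶ A) :=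
      (IsProjective.iff_projective _).2 ((projective_iff_hasProjectiveDimensionLE_zero _).2 h)
    obtain ⟨m, p, hp⟩ := hT A
    have := epi_of_surjective_postcomp hp hX
    -- A splitting `σ` of `Hom(T, p)` yields an endomorphism `e` of the power of `T`. It vanishes on
    -- `kernel p`, which is itself covered by a power of `T`, so it descends to a section `τ` of
    -- `p`.
    obtain ⟨σ, hσ⟩ := Module.projective_lifting_property (postcomp T p) LinearMap.id hp
    obtain ⟨e, he⟩ := exists_eq_postcomp (σ ∘ₗ postcomp T p)
    have he' : ∀ s, σ (s ≫ p) = s ≫ e := fun s => congr($he s)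
    have hσ' : ∀ t, σ t ≫ p = t := fun t => congr($hσ t)
    obtain ⟨k, q, hq⟩ := hT (kernel p)
    have := epi_of_surjective_postcomp hq hX
    obtain ⟨τ, hτ⟩ := (IsSES.of_epi p).exists_desc e (by
      rw [← cancel_epi q, comp_zero]
      apply biproduct.hom_ext'
      intro i
      rw [← Category.assoc q, ← Category.assoc, ← he']
      simp)
    refine ⟨m, ⟨τ, p, ?_⟩⟩
    rw [← cancel_epi p]
    apply biproduct.hom_ext'
    intro i
    rw [reassoc_of% hτ, ← Category.assoc, ← he', hσ', Category.comp_id]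
  | succ n ih =>
    obtain ⟨m, p, hp⟩ := hT A
    have := epi_of_surjective_postcomp hp hX
    have hk := IsSES.of_epi p
    obtain ⟨h1, h2⟩ := exact_postcomp (T := T) hk
    exact hasResolution_succ_iff.2 ⟨_, _, _, p, hk, addClosure_power T m,
      ih ((hasProjectiveDimensionLE_iff_of_exact h1 h2 hp n).1 h)⟩

/-- Approximating `A`, then the kernel of that approximation, presents `Hom(T, A)` by finite free
modules. -/
lemma finitePresentation_hom (hX : IsResolving (addClosure T)) (hT : HasApproximations T)
    (A : 𝒜) : Module.FinitePresentation (AuslanderAlgebra T) (T ⟶ A) := by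
  obtain ⟨m, p, hp⟩ := hT A
  have := epi_of_surjective_postcomp hp hX
  have hk := IsSES.of_epi p
  obtain ⟨h1, h2⟩ := exact_postcomp (T := T) hk
  refine Module.finitePresentation_of_surjective (postcomp T p) hp ?_
  obtain ⟨k, q, hq⟩ := hT (kernel p)
  have : Module.Finite (AuslanderAlgebra T) (T ⟶ kernel p) :=
    Module.Finite.of_surjective (postcomp T q) hq
  rw [h2.linearMap_ker_eq, LinearMap.range_eq_map]
  exact Module.Finite.fg_top.map _

lemma fpGlobalDim_lt_top_of_hasResolution (hX : IsResolving (addClosure T))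
    (hT : HasApproximations T) (d : ℕ) (h : ∀ A, HasResolution (addClosure T) d A) :
    fpGlobalDim (AuslanderAlgebra T) < ⊤ := by
  -- A finite free presentation comes from some `φ` between powers of `T`. It accounts for the 2,
  -- and its kernel `Hom(T, kernel φ)` accounts for `d`.
  suffices fpGlobalDim (AuslanderAlgebra T) ≤ ((d + 2 : ℕ) : WithBot ℕ∞) from
    this.trans_lt (WithBot.coe_lt_coe.2 (ENat.natCast_lt_top (d + 2)))
  refine iSup₂_le fun M hM => ?_
  rw [projectiveDimension_le_iff]
  obtain ⟨n, m, F, G, hF, hGF⟩ := Module.FinitePresentation.exists_fin' (AuslanderAlgebra T) M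
  let F' := F ∘ₗ (homPowerEquiv T n).toLinearMap
  have hF' : Function.Surjective F' := hF.comp (homPowerEquiv T n).surjective
  let G' := (homPowerEquiv T n).symm.toLinearMap ∘ₗ G ∘ₗ (homPowerEquiv T m).toLinearMap
  have hGF' : Function.Exact G' F' := by
    intro x
    refine (hGF (homPowerEquiv T n x)).trans ⟨?_, ?_⟩
    · rintro ⟨y, hy⟩
      exact ⟨(homPowerEquiv T m).symm y, by simp [G', hy]⟩
    · rintro ⟨y, rfl⟩
      exact ⟨homPowerEquiv T m y, by simp [G']⟩
  obtain ⟨φ, hφ⟩ := exists_eq_postcomp G'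
  have h1 := hasProjectiveDimensionLE_iff_of_exact (Submodule.subtype_injective F'.ker)
    (LinearMap.exact_subtype_ker_map F') hF' (d + 1)
  refine h1.2 ?_
  let G'' : (T ⟶ ⨁ fun _ : Fin m => T) →ₗ[AuslanderAlgebra T] F'.ker :=
    G'.codRestrict _ fun x => hGF'.apply_apply_eq_zero x
  refine (hasProjectiveDimensionLE_iff_of_exact (f := postcomp T (kernel.ι φ)) (g := G'')
    ?_ ?_ ?_ d).2 (hasProjectiveDimensionLE_hom hX hT (h _))
  · exact fun s t hst => (cancel_mono (kernel.ι φ)).1 hst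
  · intro t
    have : G'' t = 0 ↔ t ≫ φ = 0 := by
      rw [Subtype.ext_iff]
      exact iff_of_eq congr($hφ t = 0)
    rw [this]
    constructor
    · exact fun ht => ⟨kernel.lift φ t ht, kernel.lift_ι _ _ _⟩
    · rintro ⟨s, rfl⟩
      simp
  · rintro ⟨x, hx⟩
    obtain ⟨y, hy⟩ := (hGF' x).1 hx
    exact ⟨y, Subtype.ext hy⟩

lemma catResDim_lt_top_of_fpGlobalDim (hX : IsResolving (addClosure T))
    (hT : HasApproximations T) (h : fpGlobalDim (AuslanderAlgebra T) < ⊤) :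
    catResDim (addClosure T) < ⊤ := by
  obtain ⟨d, hd⟩ : ∃ d : ℕ, fpGlobalDim (AuslanderAlgebra T) ≤ (d : WithBot ℕ∞) := by
    generalize fpGlobalDim (AuslanderAlgebra T) = x at h
    induction x with
    | bot => exact ⟨0, bot_le⟩
    | coe x =>
      obtain ⟨d, rfl⟩ := ENat.ne_top_iff_exists.1 (WithBot.coe_lt_coe.1 h).ne
      exact ⟨d, le_rfl⟩
  refine (catResDim_lt_top_iff hX).2 ⟨d, fun A => ?_⟩
  refine hasResolution_of_hasProjectiveDimensionLE hX hT ((projectiveDimension_le_iff _ d).1 ?_)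
  exact (le_iSup₂ (f := fun (M : ModuleCat.{v} (AuslanderAlgebra T))
    (_ : Module.FinitePresentation (AuslanderAlgebra T) M) => projectiveDimension M) _
    (finitePresentation_hom hX hT A)).trans hd

end

/-! ### Existence of representation generators -/

section

variable {𝒜 : Type u} [Category.{v} 𝒜] [Abelian 𝒜] {X : ObjectProperty 𝒜}

open ZeroObject in
lemma IsResolving.biproduct (hX : IsResolving X) {n : ℕ} (F : Fin n → 𝒜) (hF : ∀ i, X (F i)) :
    X (⨁ F) := by
  induction n with
  | zero =>
    refine hX.projective _ (IsZero.projective ?_)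
    rw [IsZero.iff_id_eq_zero]
    exact biproduct.hom_ext _ _ fun i => i.elim0
  | succ n ih =>
    refine hX.of_ses (f := biproduct.desc fun i : Fin n => biproduct.ι F i.succ)
      (g := biproduct.π F 0) ?_ (ih (fun i => F i.succ) fun i => hF _) (hF 0)
    have h : (biproduct.desc fun i : Fin n => biproduct.ι F i.succ) ≫
        (biproduct.lift fun i : Fin n => biproduct.π F i.succ) = 𝟙 _ := by
      apply biproduct.hom_ext'
      intro i
      apply biproduct.hom_ext
      intro j
      by_cases hij : i = j
      · subst hij
        simp
      · simp [biproduct.ι_π_ne _ hij,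
          biproduct.ι_π_ne F (fun h => hij (Fin.succ_injective _ h))]
    refine IsSES.of_lift ?_ (SplitMono.mono ⟨_, h⟩) inferInstance fun D t ht => ?_
    · apply biproduct.hom_ext'
      intro i
      simp [biproduct.ι_π_ne F (Fin.succ_ne_zero i)]
    · refine ⟨biproduct.lift fun i => t ≫ biproduct.π F i.succ, ?_⟩
      rw [biproduct.lift_desc]
      conv_rhs => rw [← Category.comp_id t, ← biproduct.total, Fin.sum_univ_succ,
        Preadditive.comp_add, reassoc_of% ht, zero_comp, zero_add, Preadditive.comp_sum]
      simp

/-- A resolving subcategory closed under direct summands which is of finite representation type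
has a representation generator. -/
lemma IsOfFiniteRepType.exists_isRepGenerator (h : IsOfFiniteRepType X) (hX : IsResolving X)
    (hr : ∀ A B : 𝒜, Retract A B → X B → X A) : ∃ T : 𝒜, IsRepGenerator X T := by
  have := h.finite_ind.to_subtype
  obtain ⟨n, ⟨e⟩⟩ := Finite.exists_equiv_fin (indClasses X)
  choose G hG hG' using fun c : indClasses X => c.2
  let F : Fin n → 𝒜 := fun i => G (e.symm i)
  have hF : X (⨁ F) := hX.biproduct F fun i => (hG _).1
  refine ⟨⨁ F, le_antisymm (fun A hA => ?_) ?_⟩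
  · obtain ⟨m, E, hE, ⟨f⟩⟩ := h.isKrullSchmidt.decomposition A hA
    have hret : ∀ i, Nonempty (Retract (E i) (⨁ F)) := fun i => by
      let c : indClasses X := ⟨_, E i, hE i, rfl⟩
      obtain ⟨g⟩ : Nonempty (G c ≅ E i) := Quotient.exact (hG' c)
      have hc : F (e c) = G c := by simp [F]
      refine ⟨(g.symm ≪≫ eqToIso hc.symm).retract.trans
        ⟨biproduct.ι F (e c), biproduct.π F (e c), by simp⟩⟩
    let r i := (hret i).some
    refine ⟨m, ⟨f.retract.trans ⟨biproduct.map fun i => (r i).i, biproduct.map fun i => (r i).r, ?_⟩⟩⟩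
    ext
    simp
  · rintro A ⟨m, ⟨r⟩⟩
    exact hr _ _ r (hX.biproduct _ fun _ => hF)

end

end GorCM

/-! ### The characterizations of Gorenstein categories of finite CM-type -/

theorem corollary6p13 (𝒜 : Type u) [Category.{v} 𝒜] [Abelian 𝒜] [EnoughProjectives 𝒜] :
    (GorCM.IsGorenstein 𝒜 ↔
      ∃ X : ObjectProperty 𝒜, X ≤ GorCM.GProj 𝒜 ∧ GorCM.IsResolving X ∧
        GorCM.catResDim X < ⊤) ∧
    ((GorCM.IsGorenstein 𝒜 ∧ GorCM.IsOfFiniteCMType 𝒜) ↔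
      ∃ X : ObjectProperty 𝒜, X ≤ GorCM.GProj 𝒜 ∧ GorCM.IsResolving X ∧
        GorCM.IsOfFiniteRepType X ∧ GorCM.catResDim X < ⊤) ∧
    (∀ (R : Type w) [CommRing R] [Linear R 𝒜],
      (∀ A B : 𝒜, Module.Finite R (A ⟶ B)) →
      List.TFAE [
        GorCM.IsGorenstein 𝒜 ∧ GorCM.IsOfFiniteCMType 𝒜,
        ∃ X : ObjectProperty 𝒜, X ≤ GorCM.GProj 𝒜 ∧ GorCM.IsResolving X ∧
          GorCM.IsOfFiniteRepType X ∧
          ∃ T : 𝒜, GorCM.IsRepGenerator X T ∧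
            GorCM.fpGlobalDim (GorCM.AuslanderAlgebra T) < ⊤,
        ∃ X : ObjectProperty 𝒜, X ≤ GorCM.GProj 𝒜 ∧ GorCM.IsResolving X ∧
          GorCM.IsOfFiniteRepType X ∧ (∃ T : 𝒜, GorCM.IsRepGenerator X T) ∧
          ∀ T : 𝒜, GorCM.IsRepGenerator X T →
            GorCM.fpGlobalDim (GorCM.AuslanderAlgebra T) < ⊤]) := by
  have hres := GorCM.isResolving_GProj 𝒜
  have key : (GorCM.IsGorenstein 𝒜 ∧ GorCM.IsOfFiniteCMType 𝒜) ↔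
      ∃ X : ObjectProperty 𝒜, X ≤ GorCM.GProj 𝒜 ∧ GorCM.IsResolving X ∧
        GorCM.IsOfFiniteRepType X ∧ GorCM.catResDim X < ⊤ := by
    constructor
    · exact fun ⟨h, h'⟩ => ⟨_, le_rfl, hres, h', h⟩
    · rintro ⟨X, hle, hX, hfin, hdim⟩
      obtain rfl := GorCM.eq_GProj_of_catResDim_lt_top hX hle hdim
      exact ⟨hdim, hfin⟩
  refine ⟨⟨fun h => ⟨_, le_rfl, hres, h⟩, ?_⟩, key, fun R _ _ hR => ?_⟩
  · rintro ⟨X, hle, -, hdim⟩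
    exact (GorCM.catResDim_mono hle).trans_lt hdim
  · tfae_have 1 → 3 := by
      rintro ⟨hG, hfin⟩
      refine ⟨_, le_rfl, hres, hfin, GorCM.IsOfFiniteRepType.exists_isRepGenerator hfin hres
        fun A B r => GorCM.GProj_of_retract r, fun T hT => ?_⟩
      obtain ⟨d, hd⟩ := (GorCM.catResDim_lt_top_iff hres).1 hG
      have hT : GorCM.GProj 𝒜 = GorCM.addClosure T := hT
      rw [hT] at hres hd
      exact GorCM.fpGlobalDim_lt_top_of_hasResolution hres
        (GorCM.hasApproximations_of_finite R T fun A => hR T A) d hd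
    tfae_have 3 → 2 := by
      rintro ⟨X, hle, hX, hfin, ⟨T, hT⟩, h⟩
      exact ⟨X, hle, hX, hfin, T, hT, h T hT⟩
    tfae_have 2 → 1 := by
      rintro ⟨X, hle, hX, hfin, T, hT, h⟩
      obtain rfl : X = GorCM.addClosure T := hT
      exact key.2 ⟨_, hle, hX, hfin, GorCM.catResDim_lt_top_of_fpGlobalDim hX
        (GorCM.hasApproximations_of_finite R T fun A => hR T A) h⟩
    tfae_finish
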